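/- Let $U\subset\mathbb C$ be an open set conformally equivalent to the unit disc $\mathbb D$, let $W$ be a complex Banach space, and let $\mathscr F$ be an admissible Banach space of analytic functions $U\to W$. Admissible means: (a) for each $w\in U$ the evaluation map $\mathscr F\to W$, $f\mapsto f(w)$, is bounded; (b) if $\varphi:U\to\mathbb D$ is a conformal equivalence, then an analytic function $F:U\to W$ belongs to $\mathscr F$ if and only if $\varphi\cdot F$ does, and in this case $\|\varphi\cdot F\|_{\mathscr F}=\|F\|_{\mathscr F}$. Fix $z\in U$. For $n\ge 1$ let $$\mathscr Z^{(n)}=\{(x_{n-1},\dots,x_0)\in W^n:\ \text{there is } f\in\mathscr F \text{ with } x_i=f^{(i)}(z)/i! \text{ for all } 0\le i<n\},$$ normed by the infimum of $\|f\|_{\mathscr F}$ over all such $f$. For $n>k\ge1$ the natural quotient map $\mathscr Z^{(n)}\to\mathscr Z^{(k)}$ is $(x_{n-1},\dots,x_0)\mapsto(x_{k-1},\dots,x_0)$. A bounded operator is strictly singular if its restriction to an infinite-dimensional subspace of its domain is never an isomorphism onto its image. If the natural quotient map $\mathscr Z^{(2)}\to\mathscr Z^{(1)}$ is strictly singular,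 then the natural quotient map $\mathscr Z^{(n)}\to\mathscr Z^{(k)}$ is strictly singular for all integers $n>k\ge1$. -/

import Mathlib

/-- An operator between normed spaces is strictly singular if its restriction to an
infinite-dimensional subspace of its domain is never an isomorphism onto its image, i.e. it is
not bounded below on any infinite-dimensional subspace. -/
def IsStrictlySingular {A B : Type*} [NormedAddCommGroup A] [NormedSpace ℂ A]
    [NormedAddCommGroup B] [NormedSpace ℂ B] (T : A →L[ℂ] B) : Prop :=
  ∀ V : Submodule ℂ A, ¬ FiniteDimensional ℂ V → ¬ ∃ c : ℝ, 0 < c ∧ ∀ x ∈ V, c * ‖x‖ ≤ ‖T x‖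

/-- `φ` restricts to a conformal equivalence (biholomorphic bijection) of `U` onto the open
unit disc. -/
def IsConformalEquivDisc (U : Set ℂ) (φ : ℂ → ℂ) : Prop :=
  DifferentiableOn ℂ φ U ∧ Set.BijOn φ U (Metric.ball 0 1) ∧
    ∃ ψ : ℂ → ℂ, DifferentiableOn ℂ ψ (Metric.ball 0 1) ∧ Set.InvOn ψ φ U (Metric.ball 0 1)

/-- An admissible Banach space `𝓕` of analytic functions `U → W`, where `U` is an open set
conformally equivalent to the disc. The element `f : 𝓕` is the function `toFun f`, of which only
the values on `U` matter. -/
structure AdmissibleSpace (U : Set ℂ) (W 𝓕 : Type*) [NormedAddCommGroup W] [NormedSpace ℂ W]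
    [NormedAddCommGroup 𝓕] [NormedSpace ℂ 𝓕] where
  isOpen : IsOpen U
  exists_conformalEquiv : ∃ φ : ℂ → ℂ, IsConformalEquivDisc U φ
  toFun : 𝓕 → ℂ → W
  map_add : ∀ f g, Set.EqOn (toFun (f + g)) (toFun f + toFun g) U
  map_smul : ∀ (c : ℂ) f, Set.EqOn (toFun (c • f)) (c • toFun f) U
  injective : ∀ f g, Set.EqOn (toFun f) (toFun g) U → f = g
  differentiableOn : ∀ f, DifferentiableOn ℂ (toFun f) U
  bounded_eval : ∀ w ∈ U, ∃ C : ℝ, ∀ f, ‖toFun f w‖ ≤ C * ‖f‖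
  mem_iff_mul_mem : ∀ φ : ℂ → ℂ, IsConformalEquivDisc U φ →
    ∀ F : ℂ → W, DifferentiableOn ℂ F U →
      ((∃ f : 𝓕, Set.EqOn (toFun f) F U) ↔
        ∃ g : 𝓕, Set.EqOn (toFun g) (fun w => φ w • F w) U)
  norm_mul : ∀ φ : ℂ → ℂ, IsConformalEquivDisc U φ →
    ∀ f g : 𝓕, Set.EqOn (toFun g) (fun w => φ w • toFun f w) U → ‖g‖ = ‖f‖

namespace AdmissibleSpace

variable {U : Set ℂ} {W 𝓕 : Type*} [NormedAddCommGroup W] [NormedSpace ℂ W] [CompleteSpace W]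
  [NormedAddCommGroup 𝓕] [NormedSpace ℂ 𝓕] [CompleteSpace 𝓕]

/-- Evaluation of the `i`-th derivative at a point of `U` is a bounded operator on `𝓕`. -/
theorem exists_iteratedDeriv_clm (S : AdmissibleSpace U W 𝓕) (i : ℕ) :
    ∀ w ∈ U, ∃ L : 𝓕 →L[ℂ] W, ∀ f, L f = iteratedDeriv i (S.toFun f) w := by
  induction i with
  | zero =>
    intro w hw
    obtain ⟨C, hC⟩ := S.bounded_eval w hw
    refine ⟨LinearMap.mkContinuous ⟨⟨fun f => S.toFun f w, fun f g => S.map_add f g hw⟩,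
      fun c f => S.map_smul c f hw⟩ C hC, fun f => ?_⟩
    simp [iteratedDeriv_zero]
  | succ i ih =>
    intro w hw
    choose! L hL using ih
    have hlim : ∀ f, Filter.Tendsto (fun v => ((v - w)⁻¹ • (L v - L w)) f) (nhdsWithin w {w}ᶜ)
        (nhds (iteratedDeriv (i + 1) (S.toFun f) w)) := by
      intro f
      have han : AnalyticAt ℂ (S.toFun f) w :=
        (S.differentiableOn f).analyticAt (S.isOpen.mem_nhds hw)
      have hd : HasDerivAt (iteratedDeriv i (S.toFun f))
          (iteratedDeriv (i + 1) (S.toFun f) w) w := by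
        rw [iteratedDeriv_succ]
        have h := han.iterated_deriv i
        rw [← iteratedDeriv_eq_iterate] at h
        exact h.differentiableAt.hasDerivAt
      refine (hasDerivAt_iff_tendsto_slope.1 hd).congr' ?_
      filter_upwards [mem_nhdsWithin_of_mem_nhds (S.isOpen.mem_nhds hw)] with v hv
      simp [slope_def_module, hL v hv f, hL w hw f]
    refine ⟨continuousLinearMapOfTendsto (fun v => (v - w)⁻¹ • (L v - L w))
      (tendsto_pi_nhds.2 hlim), fun f => rfl⟩

/-- The operator that sends `f` to the list of its Taylor coefficients
`f^(i)(z) / i!`, `0 ≤ i < n`, at `z`. -/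
noncomputable def taylor (S : AdmissibleSpace U W 𝓕) (z : U) (n : ℕ) : 𝓕 →ₗ[ℂ] (Fin n → W) where
  toFun f i := ((i : ℕ).factorial : ℂ)⁻¹ • iteratedDeriv i (S.toFun f) z
  map_add' f g := by
    funext i
    obtain ⟨L, hL⟩ := S.exists_iteratedDeriv_clm i z z.2
    simp [← hL]
  map_smul' c f := by
    funext i
    obtain ⟨L, hL⟩ := S.exists_iteratedDeriv_clm i z z.2
    simp [← hL, smul_comm c]

theorem continuous_taylor (S : AdmissibleSpace U W 𝓕) (z : U) (n : ℕ) :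
    Continuous (S.taylor z n) := by
  refine continuous_pi fun i => ?_
  obtain ⟨L, hL⟩ := S.exists_iteratedDeriv_clm i z z.2
  have h : (fun f => S.taylor z n f i) = fun f => ((i : ℕ).factorial : ℂ)⁻¹ • L f := by
    funext f
    rw [hL]
    rfl
  rw [h]
  exact L.continuous.const_smul _

instance isClosed_ker_taylor (S : AdmissibleSpace U W 𝓕) (z : U) (n : ℕ) :
    IsClosed ((LinearMap.ker (S.taylor z n) : Submodule ℂ 𝓕) : Set 𝓕) :=
  isClosed_singleton.preimage (S.continuous_taylor z n)

/-- The derived space `𝒵⁽ⁿ⁾` at `z`: all lists `(x_i)_{i < n}` in `Wⁿ` that consist of the first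
`n` Taylor coefficients at `z` of some function in `𝓕`. -/
def Derived (S : AdmissibleSpace U W 𝓕) (z : U) (n : ℕ) : Type _ :=
  LinearMap.range (S.taylor z n)

noncomputable instance (S : AdmissibleSpace U W 𝓕) (z : U) (n : ℕ) :
    AddCommGroup (S.Derived z n) :=
  inferInstanceAs (AddCommGroup (LinearMap.range (S.taylor z n)))

noncomputable instance (S : AdmissibleSpace U W 𝓕) (z : U) (n : ℕ) :
    Module ℂ (S.Derived z n) :=
  inferInstanceAs (Module ℂ (LinearMap.range (S.taylor z n)))

/-- Lists of Taylor coefficients, identified with classes of functions modulo those whose first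
`n` Taylor coefficients vanish. -/
noncomputable def derivedEquiv (S : AdmissibleSpace U W 𝓕) (z : U) (n : ℕ) :
    S.Derived z n ≃ₗ[ℂ] 𝓕 ⧸ LinearMap.ker (S.taylor z n) :=
  (LinearMap.quotKerEquivRange (S.taylor z n)).symm

/-- `𝒵⁽ⁿ⁾` carries the quotient norm inherited from `𝓕`; see `norm_derived`. -/
noncomputable instance (S : AdmissibleSpace U W 𝓕) (z : U) (n : ℕ) :
    NormedAddCommGroup (S.Derived z n) :=
  NormedAddCommGroup.induced _ _ (S.derivedEquiv z n) (S.derivedEquiv z n).injective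

noncomputable instance (S : AdmissibleSpace U W 𝓕) (z : U) (n : ℕ) :
    NormedSpace ℂ (S.Derived z n) where
  norm_smul_le c x := by
    change ‖S.derivedEquiv z n (c • x)‖ ≤ ‖c‖ * ‖S.derivedEquiv z n x‖
    rw [LinearEquiv.map_smul, norm_smul]

theorem derivedEquiv_mk (S : AdmissibleSpace U W 𝓕) (z : U) (n : ℕ) (f : 𝓕) :
    S.derivedEquiv z n ⟨S.taylor z n f, f, rfl⟩ = Submodule.Quotient.mk f :=
  LinearMap.quotKerEquivRange_symm_apply_image _ _ _

theorem norm_derived_le (S : AdmissibleSpace U W 𝓕) (z : U) (n : ℕ) (x : S.Derived z n) (f : 𝓕)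
    (hf : S.taylor z n f = x.1) : ‖x‖ ≤ ‖f‖ := by
  obtain rfl : x = ⟨S.taylor z n f, f, rfl⟩ := Subtype.ext hf.symm
  change ‖S.derivedEquiv z n ⟨S.taylor z n f, f, rfl⟩‖ ≤ _
  rw [derivedEquiv_mk]
  exact Submodule.Quotient.norm_mk_le _ f

theorem exists_lift (S : AdmissibleSpace U W 𝓕) (z : U) (n : ℕ) (x : S.Derived z n)
    (ε : ℝ) (hε : 0 < ε) : ∃ f : 𝓕, S.taylor z n f = x.1 ∧ ‖f‖ < ‖x‖ + ε := by
  obtain ⟨f, hf, hlt⟩ := Submodule.Quotient.norm_mk_lt (S.derivedEquiv z n x) hε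
  refine ⟨f, ?_, hlt⟩
  rw [← derivedEquiv_mk] at hf
  exact congrArg Subtype.val ((S.derivedEquiv z n).injective hf)

/-- The norm of `x` in `𝒵⁽ⁿ⁾` is the infimum of the norms of the functions whose list of Taylor
coefficients is `x`. -/
theorem norm_derived (S : AdmissibleSpace U W 𝓕) (z : U) (n : ℕ) (x : S.Derived z n) :
    ‖x‖ = sInf ((fun f : 𝓕 => ‖f‖) '' {f | S.taylor z n f = x.1}) := by
  obtain ⟨f₀, hf₀, -⟩ := S.exists_lift z n x 1 one_pos
  symm
  refine csInf_eq_of_forall_ge_of_forall_gt_exists_lt ⟨‖f₀‖, f₀, hf₀, rfl⟩ ?_ ?_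
  · rintro _ ⟨f, hf, rfl⟩
    exact S.norm_derived_le z n x f hf
  · intro r hr
    obtain ⟨f, hf, hlt⟩ := S.exists_lift z n x (r - ‖x‖) (sub_pos.2 hr)
    exact ⟨_, ⟨f, hf, rfl⟩, by simpa using hlt⟩

/-- The natural quotient map `𝒵⁽ⁿ⁾ → 𝒵⁽ᵏ⁾`, `k ≤ n`: it keeps the coefficients `x_i`
with `i < k`. -/
noncomputable def proj (S : AdmissibleSpace U W 𝓕) (z : U) {n k : ℕ} (h : k ≤ n) :
    S.Derived z n →L[ℂ] S.Derived z k :=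
  LinearMap.mkContinuous
    { toFun := fun x => ⟨fun i => x.1 (Fin.castLE h i), by
        obtain ⟨_, f, rfl⟩ := x
        exact ⟨f, rfl⟩⟩
      map_add' := fun _ _ => rfl
      map_smul' := fun _ _ => rfl } 1 (by
    intro x
    rw [one_mul]
    refine le_of_forall_pos_lt_add fun ε hε => ?_
    obtain ⟨f, hf, hlt⟩ := S.exists_lift z n x ε hε
    refine lt_of_le_of_lt (S.norm_derived_le z k _ f ?_) hlt
    funext i
    exact congrFun hf (Fin.castLE h i))

end AdmissibleSpace

/-!
Write `Q n k : 𝒵⁽ⁿ⁾ → 𝒵⁽ᵏ⁾` for the natural quotient maps. Strict singularity passes to compositions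
and `Q n k` factors through `Q (k + 1) k`, so only `Q (k + 1) k` has to be treated, which is done
by induction on `k`; the case `k = 1` is the hypothesis.

Let `φ` be a conformal equivalence of `U` onto the disc with `φ z = 0`. Multiplication by `φ` is an
isometry of `𝓕` onto the functions vanishing at `z`, and it raises orders of vanishing at `z` by
one. It therefore induces isometric embeddings `J n : 𝒵⁽ⁿ⁾ → 𝒵⁽ⁿ⁺¹⁾` with image the kernel of
`Q (n + 1) 1` (`AdmissibleSpace.exists_shift`), and `Q (k + 2) (k + 1)` restricted to that kernel is
a copy of `Q (k + 1) k`.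

Suppose that `Q (k + 2) (k + 1)` is bounded below on an infinite-dimensional subspace `V`. The
operator `Q (k + 2) 1` factors through `Q 2 1`, so it is strictly singular, and `V` contains an
infinite sequence on which it decays as fast as desired. A small perturbation moves the span of such
a sequence into `ker Q (k + 2) 1` while `Q (k + 2) (k + 1)` stays bounded below
(`IsStrictlySingular.exists_le_ker`), which contradicts the strict singularity of `Q (k + 1) k`.

Basic sequences are not needed for the perturbation. It suffices that the unit vectors `x n` are
normed by functionals `f n` with `f m (x n) = 0` for `m < n`: the `n`-th coordinate of a vector `u`
in their span is then at most `2 ^ n * ‖u‖` (`norm_coord_le_two_pow`), and decay like `4 ^ (-n)`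
compensates for this growth.
-/

/-! ### Strictly singular operators -/

theorem IsStrictlySingular.comp_right {A B C : Type*} [NormedAddCommGroup A] [NormedSpace ℂ A]
    [NormedAddCommGroup B] [NormedSpace ℂ B] [NormedAddCommGroup C] [NormedSpace ℂ C]
    {T : B →L[ℂ] C} (hT : IsStrictlySingular T) (S : A →L[ℂ] B) :
    IsStrictlySingular (T.comp S) := by
  rintro V hV ⟨c, hc, h⟩
  have hS : ∀ x ∈ V, S x = 0 → x = 0 := by
    intro x hx h0
    have := h x hx
    simp only [ContinuousLinearMap.comp_apply, h0, map_zero, norm_zero] at this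
    exact norm_le_zero_iff.1 (nonpos_of_mul_nonpos_right this hc)
  refine hT (V.map (S : A →ₗ[ℂ] B)) ?_ ⟨c / (‖S‖ + 1), by positivity, ?_⟩
  · intro hfin
    refine hV (Submodule.fg_iff_finiteDimensional V |>.1 ?_)
    refine Submodule.fg_of_fg_map_of_fg_inf_ker (S : A →ₗ[ℂ] B)
      (Submodule.fg_iff_finiteDimensional _ |>.2 hfin) ?_
    convert Submodule.fg_bot
    rw [eq_bot_iff]
    rintro x ⟨hx, hx0⟩
    exact hS x hx hx0
  · rintro _ ⟨x, hx, rfl⟩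
    calc c / (‖S‖ + 1) * ‖S x‖ ≤ c / (‖S‖ + 1) * ((‖S‖ + 1) * ‖x‖) := by
          gcongr
          exact (S.le_opNorm x).trans (by gcongr; linarith)
      _ = c * ‖x‖ := by field_simp
      _ ≤ _ := h x hx

/-- Finitely many linear equations do not cut an infinite-dimensional space down to a
finite-dimensional one. -/
theorem Submodule.not_finiteDimensional_inf_ker {K A F : Type*} [Field K] [AddCommGroup A]
    [Module K A] [AddCommGroup F] [Module K F] [FiniteDimensional K F] {V : Submodule K A}
    (hV : ¬ FiniteDimensional K V) (Φ : A →ₗ[K] F) :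
    ¬ FiniteDimensional K (V ⊓ LinearMap.ker Φ : Submodule K A) := by
  intro hfin
  refine hV (Submodule.fg_iff_finiteDimensional V |>.1 ?_)
  exact Submodule.fg_of_fg_map_of_fg_inf_ker Φ
    (Submodule.fg_iff_finiteDimensional _ |>.2 inferInstance)
    (Submodule.fg_iff_finiteDimensional _ |>.2 hfin)

theorem IsStrictlySingular.exists_norm_eq_one {A B : Type*} [NormedAddCommGroup A]
    [NormedSpace ℂ A] [NormedAddCommGroup B] [NormedSpace ℂ B] {T : A →L[ℂ] B}
    (hT : IsStrictlySingular T) {V : Submodule ℂ A} (hV : ¬ FiniteDimensional ℂ V) {δ : ℝ}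
    (hδ : 0 < δ) : ∃ x ∈ V, ‖x‖ = 1 ∧ ‖T x‖ < δ := by
  by_contra! hcon
  refine hT V hV ⟨δ, hδ, fun x hx => ?_⟩
  rcases eq_or_ne x 0 with rfl | hx0
  · simp
  have hpos : 0 < ‖x‖ := norm_pos_iff.2 hx0
  have h := hcon (((‖x‖⁻¹ : ℝ) : ℂ) • x) (V.smul_mem _ hx)
    (by rw [norm_smul, Complex.norm_real, norm_inv, norm_norm, inv_mul_cancel₀ hpos.ne'])
  rw [map_smul, norm_smul, Complex.norm_real, norm_inv, norm_norm] at h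
  rwa [le_inv_mul_iff₀ hpos, mul_comm] at h

/-- A triangular system of unit vectors on which a strictly singular operator decays
geometrically: each `x n` is normed by the functional `f n`, and later vectors lie in the kernels
of earlier functionals. -/
theorem IsStrictlySingular.exists_triangular_seq {A B : Type*} [NormedAddCommGroup A]
    [NormedSpace ℂ A] [NormedAddCommGroup B] [NormedSpace ℂ B] {T : A →L[ℂ] B}
    (hT : IsStrictlySingular T) {V : Submodule ℂ A} (hV : ¬ FiniteDimensional ℂ V) {η : ℝ}
    (hη : 0 < η) : ∃ (x : ℕ → A) (f : ℕ → StrongDual ℂ A), (∀ n, x n ∈ V) ∧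
      (∀ n, ‖x n‖ = 1) ∧ (∀ n, ‖f n‖ ≤ 1) ∧ (∀ n, f n (x n) = 1) ∧ (∀ m n, m < n → f m (x n) = 0) ∧
      ∀ n, ‖T (x n)‖ < η * (1 / 4) ^ n := by
  classical
  -- The third component is a counter that forces the geometric decay.
  obtain ⟨p, hp, hr⟩ := exists_seq_of_forall_finset_exists
    (α := A × StrongDual ℂ A × ℕ)
    (fun p => p.1 ∈ V ∧ ‖p.1‖ = 1 ∧ ‖p.2.1‖ ≤ 1 ∧ p.2.1 p.1 = 1 ∧ ‖T p.1‖ < η * (1 / 4) ^ p.2.2)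
    (fun p q => p.2.1 q.1 = 0 ∧ p.2.2 < q.2.2) (by
      intro s _
      obtain ⟨x, ⟨hxV, hxk⟩, hx1, hxT⟩ := hT.exists_norm_eq_one
        (Submodule.not_finiteDimensional_inf_ker hV
          (LinearMap.pi fun i : s => (i.1.2.1 : A →ₗ[ℂ] ℂ)))
        (δ := η * (1 / 4) ^ (s.sup (fun q => q.2.2) + 1)) (by positivity)
      obtain ⟨g, hg, hgx⟩ := exists_dual_vector'' ℂ x
      refine ⟨(x, g, s.sup (fun q => q.2.2) + 1), ⟨hxV, hx1, hg, by simp [hgx, hx1], hxT⟩, ?_⟩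
      intro q hq
      exact ⟨congrFun hxk ⟨q, hq⟩,
        Nat.lt_succ_of_le (Finset.le_sup (f := fun q : A × StrongDual ℂ A × ℕ => q.2.2) hq)⟩)
  have hmono : StrictMono fun n => (p n).2.2 := fun m n hmn => (hr m n hmn).2
  refine ⟨fun n => (p n).1, fun n => (p n).2.1, fun n => (hp n).1, fun n => (hp n).2.1,
    fun n => (hp n).2.2.1, fun n => (hp n).2.2.2.1, fun m n hmn => (hr m n hmn).1, fun n => ?_⟩
  refine (hp n).2.2.2.2.trans_le ?_
  gcongr ?_ * ?_
  exact pow_le_pow_of_le_one (by norm_num) (by norm_num) (hmono.id_le n)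

/-- Coordinates with respect to a triangular system are bounded, with a bound `2 ^ n` that does
not depend on the length of the sum. -/
theorem norm_coord_le_two_pow {A : Type*} [NormedAddCommGroup A] [NormedSpace ℂ A] {x : ℕ → A}
    {f : ℕ → StrongDual ℂ A} (hf : ∀ n, ‖f n‖ ≤ 1) (hfx : ∀ n, f n (x n) = 1)
    (h0 : ∀ m n, m < n → f m (x n) = 0) (hx : ∀ n, ‖x n‖ ≤ 1) (a : ℕ → ℂ) (N : ℕ) :
    ∀ n < N, ‖a n‖ ≤ 2 ^ n * ‖∑ i ∈ Finset.range N, a i • x i‖ := by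
  intro n
  induction n using Nat.strong_induction_on with
  | _ n ih =>
    intro hn
    set u := ∑ i ∈ Finset.range N, a i • x i with hu
    have hfu : f n u = (∑ i ∈ Finset.range n, a i * f n (x i)) + a n := by
      rw [hu, map_sum]
      simp only [map_smul, smul_eq_mul]
      rw [← Finset.sum_subset (Finset.range_subset_range.2 (Nat.succ_le_of_lt hn)),
        Finset.sum_range_succ, hfx, mul_one]
      intro i _ hi
      rw [h0 n i (by simpa using hi), mul_zero]
    have hle : ∀ v, ‖f n v‖ ≤ ‖v‖ := fun v =>
      ((f n).le_opNorm v).trans (mul_le_of_le_one_left (norm_nonneg _) (hf n))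
    have hsum : ‖∑ i ∈ Finset.range n, a i * f n (x i)‖ ≤
        ∑ i ∈ Finset.range n, 2 ^ i * ‖u‖ := by
      refine norm_sum_le_of_le _ fun i hi => ?_
      have hin := Finset.mem_range.1 hi
      rw [norm_mul]
      calc ‖a i‖ * ‖f n (x i)‖ ≤ ‖a i‖ * 1 := by
            gcongr
            exact (hle _).trans (hx i)
        _ ≤ _ := by rw [mul_one]; exact ih i hin (hin.trans hn)
    rw [← Finset.sum_mul, geom_sum_eq (by norm_num)] at hsum
    have han : a n = f n u - ∑ i ∈ Finset.range n, a i * f n (x i) := by rw [hfu]; ring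
    calc ‖a n‖ ≤ ‖f n u‖ + ‖∑ i ∈ Finset.range n, a i * f n (x i)‖ := by
          rw [han]; exact norm_sub_le _ _
      _ ≤ ‖u‖ + (2 ^ n - 1) / (2 - 1) * ‖u‖ := add_le_add (hle u) hsum
      _ = 2 ^ n * ‖u‖ := by ring

/-- If `S` is bounded below on an infinite-dimensional subspace and the strictly singular operator
`T` satisfies `dist x (ker T) ≤ ‖T x‖`, then `S` is bounded below on an infinite-dimensional
subspace of `ker T`. The subspace is spanned by small perturbations of a triangular system on
which `T` decays geometrically. -/
theorem IsStrictlySingular.exists_le_ker {A B C : Type*} [NormedAddCommGroup A]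
    [NormedSpace ℂ A] [NormedAddCommGroup B] [NormedSpace ℂ B] [NormedAddCommGroup C]
    [NormedSpace ℂ C] {T : A →L[ℂ] B} (hT : IsStrictlySingular T)
    (hker : ∀ x, ∀ δ > ‖T x‖, ∃ y, T y = 0 ∧ ‖x - y‖ < δ) (S : A →L[ℂ] C)
    {V : Submodule ℂ A} (hV : ¬ FiniteDimensional ℂ V) {c : ℝ} (hc : 0 < c)
    (hS : ∀ x ∈ V, c * ‖x‖ ≤ ‖S x‖) :
    ∃ Y : Submodule ℂ A, ¬ FiniteDimensional ℂ Y ∧ (∀ y ∈ Y, T y = 0) ∧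
      ∃ c' : ℝ, 0 < c' ∧ ∀ y ∈ Y, c' * ‖y‖ ≤ ‖S y‖ := by
  set η : ℝ := min (1 / 4) (c / (4 * (‖S‖ + 1))) with hη_def
  have hη : 0 < η := lt_min (by norm_num) (by positivity)
  have hη1 : 2 * η ≤ 1 / 2 := by linarith [min_le_left (1 / 4) (c / (4 * (‖S‖ + 1)))]
  have hη2 : ‖S‖ * (2 * η) ≤ c / 2 := by
    have h : η * (4 * (‖S‖ + 1)) ≤ c := (le_div_iff₀ (by positivity)).1 (min_le_right _ _)
    nlinarith
  obtain ⟨x, f, hxV, hx1, hf, hfx, h0, hTx⟩ := hT.exists_triangular_seq hV hη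
  choose y hy0 hxy using fun n => hker (x n) _ (hTx n)
  -- The perturbation `x n ↦ y n` extends linearly, with small relative error.
  have key : ∀ a : ℕ →₀ ℂ, ‖Finsupp.linearCombination ℂ x a - Finsupp.linearCombination ℂ y a‖ ≤
      2 * η * ‖Finsupp.linearCombination ℂ x a‖ ∧
      (Finsupp.linearCombination ℂ x a = 0 → a = 0) ∧ Finsupp.linearCombination ℂ x a ∈ V := by
    intro a
    set N := a.support.sup id + 1 with hN
    have hsub : a.support ⊆ Finset.range N := fun i hi =>
      Finset.mem_range.2 (Nat.lt_succ_of_le (Finset.le_sup (f := id) hi))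
    have hsum : ∀ v : ℕ → A,
        Finsupp.linearCombination ℂ v a = ∑ i ∈ Finset.range N, a i • v i := fun v => by
      rw [Finsupp.linearCombination_apply, Finsupp.sum_of_support_subset a hsub _ (by simp)]
    have hcoord := norm_coord_le_two_pow hf hfx h0 (fun n => (hx1 n).le) a N
    rw [← hsum x] at hcoord
    refine ⟨?_, fun hzero => ?_, ?_⟩
    · set r := ‖Finsupp.linearCombination ℂ x a‖
      rw [hsum, hsum, ← Finset.sum_sub_distrib]
      calc ‖∑ i ∈ Finset.range N, (a i • x i - a i • y i)‖
          ≤ ∑ i ∈ Finset.range N, (1 / 2) ^ i * (η * r) := by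
            refine norm_sum_le_of_le _ fun i hi => ?_
            rw [← smul_sub, norm_smul]
            calc ‖a i‖ * ‖x i - y i‖ ≤ (2 ^ i * r) * (η * (1 / 4) ^ i) := by
                  gcongr
                  · exact hcoord i (Finset.mem_range.1 hi)
                  · exact (hxy i).le
              _ = (2 * (1 / 4)) ^ i * (η * r) := by rw [mul_pow]; ring
              _ = (1 / 2) ^ i * (η * r) := by norm_num
        _ ≤ 2 * (η * r) := by
            rw [← Finset.sum_mul]
            gcongr
            exact sum_geometric_two_le N
        _ = 2 * η * r := by ring
    · ext i
      by_cases hi : i ∈ a.support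
      · simpa [hzero] using hcoord i (Finset.mem_range.1 (hsub hi))
      · simpa using hi
    · rw [hsum]
      exact V.sum_mem fun i _ => V.smul_mem _ (hxV i)
  have hinj : LinearIndependent ℂ y := by
    rw [linearIndependent_iff]
    intro a ha
    obtain ⟨h1, h2, -⟩ := key a
    rw [ha, sub_zero] at h1
    exact h2 (norm_le_zero_iff.1 (by
      nlinarith [norm_nonneg (Finsupp.linearCombination ℂ x a)]))
  refine ⟨LinearMap.range (Finsupp.linearCombination ℂ y), ?_, ?_, c / 4, by positivity, ?_⟩
  · intro hfin
    have := (LinearEquiv.ofInjective _ hinj).symm.finiteDimensional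
    exact not_finite_iff_infinite.2 inferInstance
      (Module.Finite.finite_basis (Finsupp.basisSingleOne (R := ℂ) (ι := ℕ)))
  · rintro _ ⟨a, rfl⟩
    simp [Finsupp.linearCombination_apply, Finsupp.sum, hy0]
  · rintro _ ⟨a, rfl⟩
    obtain ⟨h1, -, h3⟩ := key a
    set u := Finsupp.linearCombination ℂ x a
    set v := Finsupp.linearCombination ℂ y a
    have hv : ‖v‖ ≤ 2 * ‖u‖ := by
      have := norm_sub_norm_le v u
      rw [norm_sub_rev] at this
      nlinarith [norm_nonneg u]
    have hSuv : ‖S u‖ - ‖S v‖ ≤ c / 2 * ‖u‖ := by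
      calc ‖S u‖ - ‖S v‖ ≤ ‖S (u - v)‖ := by rw [map_sub]; exact norm_sub_norm_le _ _
        _ ≤ ‖S‖ * (2 * η * ‖u‖) := (S.le_opNorm _).trans (by gcongr)
        _ = ‖S‖ * (2 * η) * ‖u‖ := by ring
        _ ≤ c / 2 * ‖u‖ := by gcongr
    have := hS u h3
    nlinarith [mul_le_mul_of_nonneg_left hv hc.le]

/-! ### Conformal equivalences onto the disc -/

/-- Composition with the Möbius automorphism of the disc that takes `a` to `0`. -/
theorem IsConformalEquivDisc.comp_mobius {U : Set ℂ} {φ : ℂ → ℂ} (hφ : IsConformalEquivDisc U φ)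
    {a : ℂ} (ha : ‖a‖ < 1) :
    IsConformalEquivDisc U fun w => (φ w - a) / (1 - (starRingEnd ℂ) a * φ w) := by
  -- The Möbius map with parameter `b` maps the disc into itself and is inverted by that with `-b`.
  have hden : ∀ b w : ℂ, ‖b‖ < 1 → ‖w‖ < 1 → 1 - (starRingEnd ℂ) b * w ≠ 0 := by
    intro b w hb hw h
    have h1 : ‖(starRingEnd ℂ) b * w‖ = 1 := by rw [← sub_eq_zero.1 h, norm_one]
    rw [norm_mul, RCLike.norm_conj] at h1
    nlinarith [norm_nonneg b, norm_nonneg w]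
  have hmaps : ∀ b w : ℂ, ‖b‖ < 1 → ‖w‖ < 1 →
      ‖(w - b) / (1 - (starRingEnd ℂ) b * w)‖ < 1 := by
    intro b w hb hw
    rw [norm_div, div_lt_one (norm_pos_iff.2 (hden b w hb hw))]
    refine lt_of_pow_lt_pow_left₀ 2 (norm_nonneg _) ?_
    have hb2 : ‖b‖ ^ 2 < 1 := by nlinarith [norm_nonneg b]
    have hw2 : ‖w‖ ^ 2 < 1 := by nlinarith [norm_nonneg w]
    have hpos := mul_pos (sub_pos.2 hb2) (sub_pos.2 hw2)
    simp only [Complex.sq_norm, Complex.normSq_apply, Complex.sub_re, Complex.sub_im,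
      Complex.mul_re, Complex.mul_im, Complex.conj_re, Complex.conj_im, Complex.one_re,
      Complex.one_im] at hpos ⊢
    nlinarith [hpos]
  have hinv : ∀ b w : ℂ, ‖b‖ < 1 → ‖w‖ < 1 →
      ((w - b) / (1 - (starRingEnd ℂ) b * w) - (-b)) /
        (1 - (starRingEnd ℂ) (-b) * ((w - b) / (1 - (starRingEnd ℂ) b * w))) = w := by
    intro b w hb hw
    have h1 := hden b w hb hw
    have h2 := hden (-b) _ (by rwa [norm_neg]) (hmaps b w hb hw)
    have hq := div_mul_cancel₀ (w - b) h1
    rw [div_eq_iff h2, map_neg]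
    linear_combination hq
  have hdiff : ∀ b : ℂ, ‖b‖ < 1 → DifferentiableOn ℂ
      (fun w => (w - b) / (1 - (starRingEnd ℂ) b * w)) (Metric.ball 0 1) := by
    intro b hb w hw
    have h1 := hden b w hb (mem_ball_zero_iff.1 hw)
    exact DifferentiableAt.differentiableWithinAt (by fun_prop (disch := assumption))
  have ha' : ‖-a‖ < 1 := by rwa [norm_neg]
  obtain ⟨hd, hbij, ψ, hψ, hinvOn⟩ := hφ
  have hmob : Set.BijOn (fun w => (w - a) / (1 - (starRingEnd ℂ) a * w))
      (Metric.ball 0 1) (Metric.ball 0 1) := by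
    refine Set.InvOn.bijOn (f' := fun w => (w - (-a)) / (1 - (starRingEnd ℂ) (-a) * w))
      ⟨fun w hw => hinv a w ha (mem_ball_zero_iff.1 hw), fun w hw => ?_⟩
      (fun w hw => mem_ball_zero_iff.2 (hmaps a w ha (mem_ball_zero_iff.1 hw)))
      (fun w hw => mem_ball_zero_iff.2 (hmaps (-a) w ha' (mem_ball_zero_iff.1 hw)))
    simpa using hinv (-a) w ha' (mem_ball_zero_iff.1 hw)
  refine ⟨(hdiff a ha).comp hd hbij.mapsTo, hmob.comp hbij,
    fun w => ψ ((w - (-a)) / (1 - (starRingEnd ℂ) (-a) * w)),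
    hψ.comp (hdiff _ ha') fun w hw =>
      mem_ball_zero_iff.2 (hmaps (-a) w ha' (mem_ball_zero_iff.1 hw)), fun w hw => ?_,
    fun w hw => ?_⟩
  · change ψ _ = w
    rw [hinv a _ ha (mem_ball_zero_iff.1 (hbij.mapsTo hw)), hinvOn.1 hw]
  · have hw1 := mem_ball_zero_iff.1 hw
    change (φ (ψ _) - a) / (1 - (starRingEnd ℂ) a * φ (ψ _)) = w
    rw [hinvOn.2 (mem_ball_zero_iff.2 (hmaps (-a) w ha' hw1))]
    simpa using hinv (-a) w ha' hw1

theorem IsConformalEquivDisc.exists_eq_zero {U : Set ℂ} {φ : ℂ → ℂ}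
    (hφ : IsConformalEquivDisc U φ) {z : ℂ} (hz : z ∈ U) :
    ∃ φ₀ : ℂ → ℂ, IsConformalEquivDisc U φ₀ ∧ φ₀ z = 0 :=
  ⟨_, hφ.comp_mobius (mem_ball_zero_iff.1 (hφ.2.1.mapsTo hz)), by simp⟩

theorem IsConformalEquivDisc.deriv_ne_zero {U : Set ℂ} {φ : ℂ → ℂ}
    (hφ : IsConformalEquivDisc U φ) (hU : IsOpen U) {z : ℂ} (hz : z ∈ U) : deriv φ z ≠ 0 := by
  obtain ⟨hd, hbij, ψ, hψ, hinv⟩ := hφ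
  have h1 := (hd.differentiableAt (hU.mem_nhds hz)).hasDerivAt
  have h2 := (hψ.differentiableAt (Metric.isOpen_ball.mem_nhds (hbij.mapsTo hz))).hasDerivAt
  have h3 : deriv ψ (φ z) * deriv φ z = 1 := by
    refine (h2.comp z h1).unique ((hasDerivAt_id z).congr_of_eventuallyEq ?_)
    filter_upwards [hU.mem_nhds hz] with w hw using hinv.1 hw
  exact right_ne_zero_of_mul_eq_one h3

/-- An analytic function vanishing at the zero `z` of a conformal equivalence `φ` is divisible
by `φ`. -/
theorem IsConformalEquivDisc.exists_eqOn_smul {U : Set ℂ} {W : Type*} [NormedAddCommGroup W]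
    [NormedSpace ℂ W] [CompleteSpace W] {φ : ℂ → ℂ} (hφ : IsConformalEquivDisc U φ)
    (hU : IsOpen U) {z : ℂ} (hz : z ∈ U) (hφz : φ z = 0) {g : ℂ → W}
    (hg : DifferentiableOn ℂ g U) (hgz : g z = 0) :
    ∃ F : ℂ → W, DifferentiableOn ℂ F U ∧ Set.EqOn g (fun w => φ w • F w) U := by
  have hn := hU.mem_nhds hz
  have hne : ∀ w ∈ U, dslope φ z w ≠ 0 := by
    intro w hw h0
    rcases eq_or_ne w z with rfl | hwz
    · rw [dslope_same] at h0
      exact hφ.deriv_ne_zero hU hz h0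
    · have := sub_smul_dslope φ z w
      rw [h0, smul_zero, eq_comm, sub_eq_zero] at this
      exact hwz (hφ.2.1.injOn hw hz this)
  -- The quotient `g / φ`, with the singularity at `z` removed.
  refine ⟨fun w => (dslope φ z w)⁻¹ • dslope g z w,
    (((Complex.differentiableOn_dslope hn).2 hφ.1).inv hne).smul
      ((Complex.differentiableOn_dslope hn).2 hg), fun w hw => ?_⟩
  have h1 := sub_smul_dslope φ z w
  have h2 := sub_smul_dslope g z w
  rw [hφz, sub_zero, smul_eq_mul] at h1
  rw [hgz, sub_zero] at h2
  change g w = φ w • (dslope φ z w)⁻¹ • dslope g z w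
  rw [smul_smul, ← h1, mul_assoc, mul_inv_cancel₀ (hne w hw), mul_one, h2]

/-! ### Multiplication by a conformal equivalence -/

namespace AdmissibleSpace

variable {U : Set ℂ} {W 𝓕 : Type*} [NormedAddCommGroup W] [NormedSpace ℂ W]
  [NormedAddCommGroup 𝓕] [NormedSpace ℂ 𝓕]

theorem exists_mul (S : AdmissibleSpace U W 𝓕) {φ : ℂ → ℂ} (hφ : IsConformalEquivDisc U φ)
    (f : 𝓕) : ∃ g : 𝓕, Set.EqOn (S.toFun g) (fun w => φ w • S.toFun f w) U :=
  (S.mem_iff_mul_mem φ hφ _ (S.differentiableOn f)).1 ⟨f, fun _ _ => rfl⟩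

/-- Multiplication by a conformal equivalence onto the disc, as an isometry of `𝓕`. -/
noncomputable def mul (S : AdmissibleSpace U W 𝓕) {φ : ℂ → ℂ} (hφ : IsConformalEquivDisc U φ) :
    𝓕 →ₗᵢ[ℂ] 𝓕 where
  toFun f := (S.exists_mul hφ f).choose
  map_add' f g := S.injective _ _ fun w hw => by
    rw [(S.exists_mul hφ (f + g)).choose_spec hw, S.map_add _ _ hw, Pi.add_apply,
      (S.exists_mul hφ f).choose_spec hw, (S.exists_mul hφ g).choose_spec hw]
    simp [S.map_add f g hw]
  map_smul' c f := S.injective _ _ fun w hw => by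
    rw [(S.exists_mul hφ (c • f)).choose_spec hw, RingHom.id_apply, S.map_smul _ _ hw,
      Pi.smul_apply, (S.exists_mul hφ f).choose_spec hw]
    simp [S.map_smul c f hw, smul_comm c]
  norm_map' f := S.norm_mul φ hφ f _ (S.exists_mul hφ f).choose_spec

theorem eqOn_mul (S : AdmissibleSpace U W 𝓕) {φ : ℂ → ℂ} (hφ : IsConformalEquivDisc U φ)
    (f : 𝓕) : Set.EqOn (S.toFun (S.mul hφ f)) (φ • S.toFun f) U :=
  (S.exists_mul hφ f).choose_spec

variable [CompleteSpace W]

theorem exists_mul_eq (S : AdmissibleSpace U W 𝓕) {φ : ℂ → ℂ} (hφ : IsConformalEquivDisc U φ)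
    {z : ℂ} (hz : z ∈ U) (hφz : φ z = 0) (g : 𝓕) (hg : S.toFun g z = 0) :
    ∃ f, S.mul hφ f = g := by
  obtain ⟨F, hF, hgF⟩ := hφ.exists_eqOn_smul S.isOpen hz hφz (S.differentiableOn g) hg
  obtain ⟨f, hf⟩ := (S.mem_iff_mul_mem φ hφ F hF).2 ⟨g, hgF⟩
  refine ⟨f, S.injective _ _ fun w hw => ?_⟩
  rw [S.eqOn_mul hφ f hw, hgF hw, Pi.smul_apply', hf hw]

variable [CompleteSpace 𝓕]

theorem taylor_eq_zero_iff (S : AdmissibleSpace U W 𝓕) (z : U) (n : ℕ) (f : 𝓕) :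
    S.taylor z n f = 0 ↔ (n : ℕ∞) ≤ analyticOrderAt (S.toFun f) z := by
  rw [natCast_le_analyticOrderAt_iff_iteratedDeriv_eq_zero
    ((S.differentiableOn f).analyticAt (S.isOpen.mem_nhds z.2))]
  constructor
  · intro h i hi
    have h1 : ((i.factorial : ℕ) : ℂ)⁻¹ • iteratedDeriv i (S.toFun f) z = 0 :=
      congrFun h ⟨i, hi⟩
    exact (smul_eq_zero.1 h1).resolve_left
      (inv_ne_zero (Nat.cast_ne_zero.2 i.factorial_ne_zero))
  · intro h
    funext i
    change ((i : ℕ).factorial : ℂ)⁻¹ • iteratedDeriv i (S.toFun f) z = 0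
    rw [h i i.2, smul_zero]

theorem taylor_mul_eq_zero_iff (S : AdmissibleSpace U W 𝓕) (z : U) {φ : ℂ → ℂ}
    (hφ : IsConformalEquivDisc U φ) (hφz : φ z = 0) (n : ℕ) (f : 𝓕) :
    S.taylor z (n + 1) (S.mul hφ f) = 0 ↔ S.taylor z n f = 0 := by
  have hU := S.isOpen.mem_nhds z.2
  have hφa : AnalyticAt ℂ φ z := hφ.1.analyticAt hU
  rw [taylor_eq_zero_iff, taylor_eq_zero_iff,
    analyticOrderAt_congr ((S.eqOn_mul hφ f).eventuallyEq_of_mem hU),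
    analyticOrderAt_smul hφa ((S.differentiableOn f).analyticAt hU),
    hφa.analyticOrderAt_eq_one_of_zero_deriv_ne_zero hφz (hφ.deriv_ne_zero S.isOpen z.2),
    Nat.cast_add, Nat.cast_one, add_comm]
  exact ENat.add_le_add_iff_left ENat.one_ne_top

theorem taylor_eq_zero_of_succ (S : AdmissibleSpace U W 𝓕) (z : U) (n : ℕ) (g : 𝓕)
    (hg : S.taylor z (n + 1) g = 0) : S.toFun g z = 0 := by
  simpa [taylor] using congrFun hg 0

/-! ### Shift embeddings of the derived spaces -/

/-- The element of `𝒵⁽ⁿ⁾` represented by a function: `taylor` with codomain `𝒵⁽ⁿ⁾`. -/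
noncomputable def jet (S : AdmissibleSpace U W 𝓕) (z : U) (n : ℕ) : 𝓕 →ₗ[ℂ] S.Derived z n :=
  (S.taylor z n).rangeRestrict

theorem proj_jet (S : AdmissibleSpace U W 𝓕) (z : U) {n k : ℕ} (h : k ≤ n) (f : 𝓕) :
    S.proj z h (S.jet z n f) = S.jet z k f := rfl

theorem jet_surjective (S : AdmissibleSpace U W 𝓕) (z : U) (n : ℕ) :
    Function.Surjective (S.jet z n) :=
  LinearMap.surjective_rangeRestrict _

theorem jet_eq_zero_iff (S : AdmissibleSpace U W 𝓕) (z : U) (n : ℕ) (f : 𝓕) :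
    S.jet z n f = 0 ↔ S.taylor z n f = 0 :=
  Subtype.ext_iff

theorem norm_jet_le (S : AdmissibleSpace U W 𝓕) (z : U) (n : ℕ) (f : 𝓕) :
    ‖S.jet z n f‖ ≤ ‖f‖ :=
  S.norm_derived_le z n _ f rfl

theorem exists_jet_eq (S : AdmissibleSpace U W 𝓕) (z : U) (n : ℕ) (x : S.Derived z n) {r : ℝ}
    (hr : ‖x‖ < r) : ∃ f, S.jet z n f = x ∧ ‖f‖ < r := by
  obtain ⟨f, hf, hlt⟩ := S.exists_lift z n x (r - ‖x‖) (sub_pos.2 hr)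
  exact ⟨f, Subtype.ext hf, by simpa using hlt⟩

/-- Multiplication by `φ` with `φ z = 0` induces an isometric embedding of `𝒵⁽ⁿ⁾` into `𝒵⁽ⁿ⁺¹⁾`.
Isometry is inherited from `𝓕`, because `φ` divides every function that vanishes at `z`. -/
theorem exists_shift (S : AdmissibleSpace U W 𝓕) (z : U) {φ : ℂ → ℂ}
    (hφ : IsConformalEquivDisc U φ) (hφz : φ z = 0) (n : ℕ) :
    ∃ J : S.Derived z n →ₗᵢ[ℂ] S.Derived z (n + 1),
      ∀ f, J (S.jet z n f) = S.jet z (n + 1) (S.mul hφ f) := by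
  have hker : ∀ f, S.jet z (n + 1) (S.mul hφ f) = 0 ↔ S.jet z n f = 0 := fun f => by
    rw [jet_eq_zero_iff, jet_eq_zero_iff, taylor_mul_eq_zero_iff S z hφ hφz]
  -- The map is defined through arbitrary representatives `s x`; `hJ` is well-definedness.
  choose s hs using S.jet_surjective z n
  have hJ : ∀ f, S.jet z (n + 1) (S.mul hφ (s (S.jet z n f))) =
      S.jet z (n + 1) (S.mul hφ f) := fun f => by
    rw [← sub_eq_zero, ← map_sub, ← map_sub, hker, map_sub, hs, sub_self]
  refine ⟨⟨⟨⟨fun x => S.jet z (n + 1) (S.mul hφ (s x)), fun x y => ?_⟩, fun c x => ?_⟩,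
    fun x => ?_⟩, hJ⟩
  · obtain ⟨f, rfl⟩ := S.jet_surjective z n x
    obtain ⟨g, rfl⟩ := S.jet_surjective z n y
    rw [← _root_.map_add, hJ, hJ, hJ, _root_.map_add, _root_.map_add]
  · obtain ⟨f, rfl⟩ := S.jet_surjective z n x
    change S.jet z (n + 1) (S.mul hφ (s (c • S.jet z n f))) = c • S.jet z (n + 1) (S.mul hφ (s _))
    rw [← _root_.map_smul, hJ, hJ, _root_.map_smul, _root_.map_smul]
  · change ‖S.jet z (n + 1) (S.mul hφ (s x))‖ = ‖x‖
    refine le_antisymm (le_of_forall_gt fun r hr => ?_) (le_of_forall_gt fun r hr => ?_)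
    · obtain ⟨f, rfl, hf⟩ := S.exists_jet_eq z n x hr
      rw [hJ]
      exact (S.norm_jet_le z _ _).trans_lt (by rwa [LinearIsometry.norm_map])
    · -- A representative of `J x` vanishes at `z`, so division by `φ` represents `x`.
      obtain ⟨g, hg, hgr⟩ := S.exists_jet_eq z (n + 1) _ hr
      have h0 : S.toFun (g - S.mul hφ (s x)) z = 0 :=
        S.taylor_eq_zero_of_succ z n _ ((S.jet_eq_zero_iff z _ _).1 (by rw [map_sub, hg, sub_self]))
      obtain ⟨d, hd⟩ := S.exists_mul_eq hφ z.2 hφz _ h0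
      have hgd : g = S.mul hφ (d + s x) := by rw [_root_.map_add, hd, sub_add_cancel]
      have hd0 : S.jet z n d = 0 := (hker d).1 (by rw [hd, map_sub, hg, sub_self])
      have hx : S.jet z n (d + s x) = x := by rw [_root_.map_add, hd0, hs, zero_add]
      calc ‖x‖ ≤ ‖d + s x‖ := by simpa only [hx] using S.norm_jet_le z n (d + s x)
        _ = ‖g‖ := by rw [hgd, LinearIsometry.norm_map]
        _ < r := hgr

theorem exists_proj_eq_zero_norm_sub_lt (S : AdmissibleSpace U W 𝓕) (z : U) {n k : ℕ}
    (h : k ≤ n) (x : S.Derived z n) (δ : ℝ) (hδ : δ > ‖S.proj z h x‖) :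
    ∃ y, S.proj z h y = 0 ∧ ‖x - y‖ < δ := by
  obtain ⟨f, hf, hlt⟩ := S.exists_jet_eq z k _ hδ
  refine ⟨x - S.jet z n f, by rw [map_sub, proj_jet, hf, sub_self], ?_⟩
  rw [sub_sub_cancel]
  exact (S.norm_jet_le z n f).trans_lt hlt

/-! ### Strict singularity of the quotient maps -/

theorem proj_comp_proj (S : AdmissibleSpace U W 𝓕) (z : U) {n m k : ℕ} (h₁ : m ≤ n) (h₂ : k ≤ m) :
    (S.proj z h₂).comp (S.proj z h₁) = S.proj z (h₂.trans h₁) := rfl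

/-- The inductive step. If `𝒵⁽ᵏ⁺²⁾ → 𝒵⁽ᵏ⁺¹⁾` is bounded below on an infinite-dimensional subspace,
then, since `𝒵⁽ᵏ⁺²⁾ → 𝒵⁽¹⁾` is strictly singular, it is bounded below on an infinite-dimensional
space of jets with vanishing value; there the map is a copy of `𝒵⁽ᵏ⁺¹⁾ → 𝒵⁽ᵏ⁾`. -/
theorem isStrictlySingular_proj_succ (S : AdmissibleSpace U W 𝓕) (z : U)
    (h : IsStrictlySingular (S.proj z (show 1 ≤ 2 by norm_num))) (k : ℕ)
    (hk : IsStrictlySingular (S.proj z k.le_succ)) :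
    IsStrictlySingular (S.proj z (k + 1).le_succ) := by
  rintro V hV ⟨c, hc, hle⟩
  obtain ⟨φ₁, hφ₁⟩ := S.exists_conformalEquiv
  obtain ⟨φ, hφ, hφz⟩ := hφ₁.exists_eq_zero z.2
  obtain ⟨J, hJ⟩ := S.exists_shift z hφ hφz (k + 1)
  obtain ⟨J', hJ'⟩ := S.exists_shift z hφ hφz k
  have hT : IsStrictlySingular (S.proj z (show 1 ≤ k + 2 by omega)) :=
    h.comp_right (S.proj z (show 2 ≤ k + 2 by omega))
  obtain ⟨Y, hY, hY0, c', hc', hYc⟩ := hT.exists_le_ker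
    (S.exists_proj_eq_zero_norm_sub_lt z _) (S.proj z (k + 1).le_succ) hV hc hle
  have hYJ : Y ≤ LinearMap.range J.toLinearMap := by
    intro y hy
    obtain ⟨g, rfl⟩ := S.jet_surjective z _ y
    have h0 := hY0 _ hy
    rw [proj_jet, jet_eq_zero_iff] at h0
    obtain ⟨f, rfl⟩ := S.exists_mul_eq hφ z.2 hφz g (S.taylor_eq_zero_of_succ z 0 g h0)
    exact ⟨S.jet z (k + 1) f, hJ f⟩
  have hcomm : ∀ x, S.proj z (k + 1).le_succ (J x) = J' (S.proj z k.le_succ x) := by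
    intro x
    obtain ⟨f, rfl⟩ := S.jet_surjective z _ x
    rw [hJ, proj_jet, proj_jet, hJ']
  refine hk (Y.comap J.toLinearMap) (fun hfin => hY ?_) ⟨c', hc', fun x hx => ?_⟩
  · rw [← Submodule.map_comap_eq_of_le hYJ]
    infer_instance
  · have := hYc _ hx
    change c' * ‖J x‖ ≤ ‖S.proj z (k + 1).le_succ (J x)‖ at this
    rwa [hcomm, J.norm_map, J'.norm_map] at this

end AdmissibleSpace

theorem mainTheorem3 {U : Set ℂ} {W 𝓕 : Type*}
    [NormedAddCommGroup W] [NormedSpace ℂ W] [CompleteSpace W]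
    [NormedAddCommGroup 𝓕] [NormedSpace ℂ 𝓕] [CompleteSpace 𝓕]
    (S : AdmissibleSpace U W 𝓕) (z : U)
    (h : IsStrictlySingular (S.proj z (show 1 ≤ 2 by norm_num)))
    (n k : ℕ) (hk : 1 ≤ k) (hkn : k < n) :
    IsStrictlySingular (S.proj z hkn.le) := by
  have hstep : IsStrictlySingular (S.proj z k.le_succ) := by
    induction k, hk using Nat.le_induction with
    | base => exact h
    | succ k hk ih => exact S.isStrictlySingular_proj_succ z h k (ih (by omega))
  rw [← S.proj_comp_proj z (Nat.succ_le_of_lt hkn) k.le_succ]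
  exact hstep.comp_right _
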